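/- **Network.** Consider a time-slotted network with a finite set $\mathcal N$ of $N$ nodes, a set $\mathcal L$ of directed links, and a finite set $\mathcal F$ of $K$ flows; flow $c$ has source node $b(c)$ and destination $d(c)\ne b(c)$, and $s(c)$ denotes its (always backlogged) transport-layer source. In slot $t$ the scheduling parameters are nonnegative integers $\mu^c_{mn}(t)$, nonzero only for $(m,n)\in\mathcal L^c=\mathcal L\cup\{(s(c),b(c))\}$, with $\mu^c_{mn}(t)\in\{0,1\}$ on $\mathcal L$, $\mu^c_{s(c)b(c)}(t)\le\mu_M$ (where $\mu_M\ge1$), $\sum_{m\in\mathcal N}\mu^c_{m\,b(c)}(t)=0$, and $\sum_c[\sum_i\mu^c_{ni}(t)+\sum_j\mu^c_{jn}(t)]\le1$ over the links at each node $n$. Node queues are integer-valued, with $U^c_n(0)=0$, $U^c_{d(c)}\equiv0$ and, for $n\ne d(c)$, $U_n^c(t+1)\le[U_n^c(t)-\sum_{i}\mu_{ni}^c(t)]^++\sum_{j:(j,n)\in\mathcal L^c}\mu_{jn}^c(t)$. **Optimal rates.** The capacity region $\Lambda$ is the set of arrival rate vectors for which some scheduling algorithm without congestion control keeps all node queues stable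 ($\limsup_t\frac1t\sum_{\tau<t}\mathbb E\,U_n^c(\tau)<\infty$, the queues obeying the exact packet balance). Let $a_c\ge0$ and $\epsilon>0$, and let $(r^*_{\epsilon,c})$ maximize $\sum_c r_c$ subject to $(r_c+\epsilon)\in\Lambda$ and $r_c\ge a_c$. **Algorithm.** Let $V>0$. The virtual queues start at $0$ and satisfy $U_{s(c)}^c(t+1)=[U_{s(c)}^c(t)-\mu^c_{s(c)b(c)}(t)]^++R_c(t)$, $Z_c(t+1)=[Z_c(t)-R_c(t)]^++a_c$, $X_c(t+1)=[X_c(t)-\rho_cR_c(t)]^++\sum_nU_n^c(t)$, where the congestion controller sets $R_c(t)=0$ if $\frac{q_M-\mu_M}{q_M}U^c_{s(c)}(t)-\rho_cX_c(t)-Z_c(t)-V>0$ and $R_c(t)=\mu_M$ otherwise. The weights are $w^c_{mn}=\frac{U^c_{s(c)}}{q_M}(U^c_m-U^c_n)$ if $(m,n)\in\mathcal L$ and $n\ne b(c)$, $w^c_{s(c)b(c)}=\frac{U^c_{s(c)}}{q_M}(q_M-\mu_M-U^c_{b(c)})$, and $w^c_{mn}=0$ otherwise; $c^*_{mn}(t)$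 is a maximizer of $c\mapsto w^c_{mn}(t)$ and $w_{mn}=[\max_cw^c_{mn}]^+$. A max-weight matching maximizes $\sum_{m,n}\mu^{c^*_{mn}}_{mn}w_{mn}$ over the scheduling parameters that satisfy the above constraints and $\mu^c_{mn}=0$ for $c\ne c^*_{mn}$. Given $\gamma\in(0,1)$, a suboptimal scheduler chooses in every slot scheduling parameters that satisfy the same constraints, vanish on pairs with $w_{mn}(t)=0$, and have weighted sum at least $\gamma$ times that of a max-weight matching. **Theorem 2.** Suppose that $q_M>\frac{2N-1+\mu_M^2}{2\gamma\epsilon}+\mu_M$, that $\rho_c>\frac{Nq_M}{\gamma r^*_{\epsilon,c}}$ for all $c$, and that for some $\epsilon_2>0$, $\gamma r^*_{\epsilon,c}\ge a_c+\epsilon_2$ for all $c$. Put $$B=\tfrac12NKq_M\mu_M+K\tfrac{q_M-\mu_M}{q_M}\mu_M^2+\tfrac12\mu_M^2\sum_c\rho_c^2+\tfrac12KN^2q_M^2+\tfrac12K\mu_M^2+\tfrac12K\sum_ca_c^2 .$$ Then there is $\epsilon_1>0$ with $\epsilon_1\le\gamma\rho_cr^*_{\epsilon,c}-Nq_M$ for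 all $c$ and $\epsilon_1\le\frac1{q_M}\bigl(\gamma\epsilon(q_M-\mu_M)-\frac{2N-1+\mu_M^2}2\bigr)$; and for every such $\epsilon_1$, with $\delta=\min\{\epsilon_1,\epsilon_2\}$, every suboptimal scheduler (with the congestion controller above) satisfies $$\limsup_{t\to\infty}\frac1t\sum_{\tau=0}^{t-1}\sum_c\mathbb E\{U^c_{s(c)}(\tau)+X_c(\tau)+Z_c(\tau)\}\le\frac{\bar B}{\delta},\qquad\bar B=B+\gamma VB_R,$$ for every constant $B_R$ such that $\limsup_{t}\frac1t\sum_{\tau<t}\sum_c\mathbb E R_c(\tau)-\gamma\sum_cr^*_{\epsilon,c}\le\gamma B_R$; in particular the left side is at most $(B+VK\mu_M)/\delta$. Moreover the throughput satisfies $$\liminf_{t\to\infty}\frac1t\sum_{\tau=0}^{t-1}\sum_c\mathbb E\{R_c(\tau)\}\ge\gamma\sum_cr^*_{\epsilon,c}-\frac BV .$$ -/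

import Mathlib

open Filter MeasureTheory

noncomputable section

namespace DelayNet

/-- A multi-hop network with node set `N` and flow set `F`: directed links, the source node `b(c)`
and destination node `d(c)` of each flow, and the bound `μ_M ≥ 1` on the number of packets that a
source node receives from the transport layer in one slot. -/
structure Network (N F : Type*) where
  link : N → N → Prop
  src : F → N
  dst : F → N
  src_ne_dst : ∀ c, src c ≠ dst c
  muM : ℝ
  one_le_muM : 1 ≤ muM

/-- Scheduling parameters `μ_{un}^c` of one slot, in packets. The transmitting end `u` is either a
node (`Sum.inl m`) or the transport-layer source `s(c')` of a flow (`Sum.inr c'`). -/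
abbrev Schedule (N F : Type*) := (N ⊕ F) → N → F → ℕ

section

variable {N F : Type*} [Fintype N] [Fintype F]

/-- Membership of the pair `(u, n)` in `L^c = L ∪ {(s(c), b(c))}`. -/
def Network.extLink (G : Network N F) (c : F) : (N ⊕ F) → N → Prop
  | Sum.inl m, n => G.link m n
  | Sum.inr c', n => c' = c ∧ n = G.src c

/-- Scheduled departures of flow `c` from node `n`. -/
def outRate (μ : Schedule N F) (n : N) (c : F) : ℕ := ∑ i : N, μ (Sum.inl n) i c

/-- Scheduled arrivals of flow `c` at node `n`, admissions from the transport layer included. -/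
def inRate (μ : Schedule N F) (n : N) (c : F) : ℕ := ∑ u : N ⊕ F, μ u n c

/-- Admitted packets of flow `c`, that is `μ_{s(c)b(c)}^c`. -/
def Network.admitted (G : Network N F) (μ : Schedule N F) (c : F) : ℕ :=
  μ (Sum.inr c) (G.src c) c

/-- The constraints of the network on the scheduling parameters of one slot. -/
structure Network.Feasible (G : Network N F) (μ : Schedule N F) : Prop where
  /-- rates only on existing pairs -/
  supported : ∀ u n c, ¬ G.extLink c u n → μ u n c = 0
  /-- at most one packet per link and slot -/
  link_le_one : ∀ m n c, μ (Sum.inl m) n c ≤ 1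
  /-- bounded admissions -/
  admitted_le : ∀ c, (G.admitted μ c : ℝ) ≤ G.muM
  /-- no looping back to the source -/
  no_return : ∀ c, ∑ m : N, μ (Sum.inl m) (G.src c) c = 0
  /-- node-exclusive interference -/
  node_exclusive : ∀ n,
    ∑ c : F, (∑ i : N, μ (Sum.inl n) i c + ∑ j : N, μ (Sum.inl j) n c) ≤ 1

/-- A scheduling algorithm without congestion control, run on a probability space: the (random)
packet arrivals at the sources and link schedules, and the resulting queues. The schedule counts
packets that are really sent (an assignment without a packet to send is the same as an idle link),
so that the queue recursion is an exact balance of packets. -/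
structure Network.OpenLoopRun (G : Network N F) {Ω : Type*} [MeasurableSpace Ω]
    (P : Measure Ω) where
  rate : ℕ → Ω → Schedule N F
  U : ℕ → Ω → N → F → ℕ
  measurable_rate : ∀ t u n c, Measurable fun ω => rate t ω u n c
  measurable_U : ∀ t n c, Measurable fun ω => U t ω n c
  feasible : ∀ t ω, G.Feasible (rate t ω)
  U_zero : ∀ ω n c, U 0 ω n c = 0
  U_dst : ∀ t ω c, U t ω (G.dst c) c = 0
  sent_le : ∀ t ω n c, outRate (rate t ω) n c ≤ U t ω n c
  U_succ : ∀ t ω n c, n ≠ G.dst c →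
    U (t + 1) ω n c = U t ω n c - outRate (rate t ω) n c + inRate (rate t ω) n c

/-- The run has long-term arrival rates `z`. -/
def Network.OpenLoopRun.HasRate {G : Network N F} {Ω : Type*} [MeasurableSpace Ω]
    {P : Measure Ω} (S : G.OpenLoopRun P) (z : F → ℝ) : Prop :=
  ∀ c, Tendsto
    (fun t : ℕ => (∑ τ ∈ Finset.range t, ∫ ω, (G.admitted (S.rate τ ω) c : ℝ) ∂P) / (t : ℝ))
    atTop (nhds (z c))

/-- All node queues are stable: `limsup (1/t) ∑_{τ<t} E U_n^c(τ) < ∞`. -/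
def Network.OpenLoopRun.Stable {G : Network N F} {Ω : Type*} [MeasurableSpace Ω]
    {P : Measure Ω} (S : G.OpenLoopRun P) : Prop :=
  ∀ n c, limsup
    (fun t : ℕ => (∑ τ ∈ Finset.range t, ∫⁻ ω, (S.U τ ω n c : ENNReal) ∂P) / (t : ENNReal))
    atTop < ⊤

/-- The capacity region `Λ`: the arrival rate vectors that some scheduling algorithm without
congestion control supports with stable node queues. -/
def Network.capacityRegion (G : Network N F) : Set (F → ℝ) :=
  {z | ∃ (Ω : Type) (_ : MeasurableSpace Ω) (P : Measure Ω) (_ : IsProbabilityMeasure P)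
    (S : G.OpenLoopRun P), S.HasRate z ∧ S.Stable}

/-- `r` solves: maximize `∑ r_c` subject to `(r_c + ε) ∈ Λ` and `r_c ≥ a_c`. -/
def Network.IsOptimalRate (G : Network N F) (a : F → ℝ) (ε : ℝ) (r : F → ℝ) : Prop :=
  ((fun c => r c + ε) ∈ G.capacityRegion ∧ ∀ c, a c ≤ r c) ∧
    ∀ r' : F → ℝ, (fun c => r' c + ε) ∈ G.capacityRegion → (∀ c, a c ≤ r' c) →
      ∑ c, r' c ≤ ∑ c, r c

open Classical in
/-- The weights `w_{un}^c`, for node queues `U` and transport-layer virtual queues `Us`. A flow that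
may not use a pair, in particular a link that leads back into its own source, has weight `0` on it.
-/
def Network.weight (G : Network N F) (qM : ℝ) (U : N → F → ℕ) (Us : F → ℝ) :
    (N ⊕ F) → N → F → ℝ
  | Sum.inl m, n, c =>
      if G.link m n ∧ n ≠ G.src c then Us c / qM * ((U m c : ℝ) - (U n c : ℝ)) else 0
  | Sum.inr c', n, c =>
      if c' = c ∧ n = G.src c then Us c / qM * (qM - G.muM - (U (G.src c) c : ℝ)) else 0

/-- `cs u n` is a choice of `c*_{un}`, a flow of maximal weight on the pair `(u, n)`. -/
def IsArgmax (w : (N ⊕ F) → N → F → ℝ) (cs : (N ⊕ F) → N → F) : Prop :=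
  ∀ u n c, w u n c ≤ w u n (cs u n)

/-- `w_{un} = [max_c w_{un}^c]^+`. -/
def pairWeight (w : (N ⊕ F) → N → F → ℝ) (cs : (N ⊕ F) → N → F) (u : N ⊕ F) (n : N) : ℝ :=
  max (w u n (cs u n)) 0

/-- The objective `∑ μ_{un}^{c*_{un}} w_{un}` of the matching problem. -/
def totalWeight (w : (N ⊕ F) → N → F → ℝ) (cs : (N ⊕ F) → N → F) (μ : Schedule N F) : ℝ :=
  ∑ u : N ⊕ F, ∑ n : N, (μ u n (cs u n) : ℝ) * pairWeight w cs u n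

/-- The constraints of the matching problem. -/
def Network.PolicyFeasible (G : Network N F) (cs : (N ⊕ F) → N → F) (μ : Schedule N F) : Prop :=
  G.Feasible μ ∧ ∀ u n c, c ≠ cs u n → μ u n c = 0

/-- `μ` solves the max-weight matching problem. -/
def Network.IsMaxWeight (G : Network N F) (w : (N ⊕ F) → N → F → ℝ) (cs : (N ⊕ F) → N → F)
    (μ : Schedule N F) : Prop :=
  G.PolicyFeasible cs μ ∧ ∀ ν, G.PolicyFeasible cs ν → totalWeight w cs ν ≤ totalWeight w cs μ

/-- `μ` is `γ`-suboptimal: it obeys the constraints of the matching problem, it assigns nothing to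
a pair of weight `0`, and its weighted sum is at least `γ` times that of a max-weight matching. -/
def Network.IsSuboptimal (G : Network N F) (γ : ℝ) (w : (N ⊕ F) → N → F → ℝ)
    (cs : (N ⊕ F) → N → F) (μ : Schedule N F) : Prop :=
  G.PolicyFeasible cs μ ∧
    (∀ u n, pairWeight w cs u n = 0 → ∀ c, μ u n c = 0) ∧
    ∃ opt, G.IsMaxWeight w cs opt ∧ γ * totalWeight w cs opt ≤ totalWeight w cs μ

open Classical in
/-- The congestion controller: the virtual input rate `R_c` from the values of `U_{s(c)}^c`, `X_c`
and `Z_c`; it minimizes `R ((q_M - μ_M) U_{s(c)}^c / q_M - X_c ρ_c - Z_c - V)` over `[0, μ_M]`. -/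
def congestionControl (muM qM V ρ us x z : ℝ) : ℝ :=
  if (qM - muM) / qM * us - x * ρ - z - V > 0 then 0 else muM

/-- A run of the network under the congestion controller and a `γ`-suboptimal scheduler: node
queues `U`, virtual queues `Us` (transport layer), `X` (delay), `Z` (service), scheduling
parameters `rate` and candidate flows `cs`. -/
structure Network.SuboptimalRun (G : Network N F) (γ qM V : ℝ) (ρ a : F → ℝ)
    {Ω : Type*} [MeasurableSpace Ω] (P : Measure Ω) where
  rate : ℕ → Ω → Schedule N F
  cs : ℕ → Ω → (N ⊕ F) → N → F
  U : ℕ → Ω → N → F → ℕ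
  Us : ℕ → Ω → F → ℝ
  X : ℕ → Ω → F → ℝ
  Z : ℕ → Ω → F → ℝ
  measurable_rate : ∀ t u n c, Measurable fun ω => rate t ω u n c
  measurable_U : ∀ t n c, Measurable fun ω => U t ω n c
  /-- candidate flows -/
  cs_argmax : ∀ t ω, IsArgmax (G.weight qM (U t ω) (Us t ω)) (cs t ω)
  /-- scheduling policy -/
  suboptimal : ∀ t ω,
    G.IsSuboptimal γ (G.weight qM (U t ω) (Us t ω)) (cs t ω) (rate t ω)
  /-- node queues: an inequality, since scheduled arrivals may find no packet to send -/
  U_zero : ∀ ω n c, U 0 ω n c = 0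
  U_dst : ∀ t ω c, U t ω (G.dst c) c = 0
  U_succ : ∀ t ω n c, n ≠ G.dst c →
    (U (t + 1) ω n c : ℝ) ≤
      max ((U t ω n c : ℝ) - (outRate (rate t ω) n c : ℝ)) 0 + (inRate (rate t ω) n c : ℝ)
  /-- virtual queues at the transport layer -/
  Us_zero : ∀ ω c, Us 0 ω c = 0
  Us_succ : ∀ t ω c, Us (t + 1) ω c =
    max (Us t ω c - (G.admitted (rate t ω) c : ℝ)) 0 +
      congestionControl G.muM qM V (ρ c) (Us t ω c) (X t ω c) (Z t ω c)
  /-- virtual service queues -/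
  Z_zero : ∀ ω c, Z 0 ω c = 0
  Z_succ : ∀ t ω c, Z (t + 1) ω c =
    max (Z t ω c -
      congestionControl G.muM qM V (ρ c) (Us t ω c) (X t ω c) (Z t ω c)) 0 + a c
  /-- virtual delay queues -/
  X_zero : ∀ ω c, X 0 ω c = 0
  X_succ : ∀ t ω c, X (t + 1) ω c =
    max (X t ω c -
      ρ c * congestionControl G.muM qM V (ρ c) (Us t ω c) (X t ω c) (Z t ω c)) 0 +
      ∑ n : N, (U t ω n c : ℝ)

/-- The virtual input rate `R_c(t)` of a run. -/
def Network.SuboptimalRun.R {G : Network N F} {γ qM V : ℝ} {ρ a : F → ℝ}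
    {Ω : Type*} [MeasurableSpace Ω] {P : Measure Ω}
    (S : G.SuboptimalRun γ qM V ρ a P) (t : ℕ) (ω : Ω) (c : F) : ℝ :=
  congestionControl G.muM qM V (ρ c) (S.Us t ω c) (S.X t ω c) (S.Z t ω c)

/-- `(1/t) ∑_{τ<t} ∑_c E R_c(τ)`, as an extended real. -/
def Network.SuboptimalRun.avgInput {G : Network N F} {γ qM V : ℝ} {ρ a : F → ℝ}
    {Ω : Type*} [MeasurableSpace Ω] {P : Measure Ω}
    (S : G.SuboptimalRun γ qM V ρ a P) (t : ℕ) : EReal :=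
  (((∑ τ ∈ Finset.range t, ∑ c, ∫ ω, S.R τ ω c ∂P) / (t : ℝ) : ℝ) : EReal)

/-- `(1/t) ∑_{τ<t} ∑_c E (U_{s(c)}^c(τ) + X_c(τ) + Z_c(τ))`, as an extended real. -/
def Network.SuboptimalRun.avgVirtual {G : Network N F} {γ qM V : ℝ} {ρ a : F → ℝ}
    {Ω : Type*} [MeasurableSpace Ω] {P : Measure Ω}
    (S : G.SuboptimalRun γ qM V ρ a P) (t : ℕ) : EReal :=
  (((∑ τ ∈ Finset.range t, ∑ c, ∫ ω, (S.Us τ ω c + S.X τ ω c + S.Z τ ω c) ∂P) / (t : ℝ) : ℝ) :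
    EReal)

/-- The constant `B`; here `N` and `K` are the numbers of nodes and of flows. -/
def Network.constB (G : Network N F) (qM : ℝ) (ρ a : F → ℝ) : ℝ :=
  1 / 2 * (Fintype.card N : ℝ) * (Fintype.card F : ℝ) * qM * G.muM
    + (Fintype.card F : ℝ) * ((qM - G.muM) / qM) * G.muM ^ 2
    + 1 / 2 * G.muM ^ 2 * ∑ c, ρ c ^ 2
    + 1 / 2 * (Fintype.card F : ℝ) * (Fintype.card N : ℝ) ^ 2 * qM ^ 2
    + 1 / 2 * (Fintype.card F : ℝ) * G.muM ^ 2
    + 1 / 2 * (Fintype.card F : ℝ) * ∑ c, a c ^ 2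

/-- The constants `ε₁ > 0` that may enter `δ = min {ε₁, ε₂}`. -/
def Network.IsMargin (G : Network N F) (γ ε qM : ℝ) (ρ r : F → ℝ) (ε₁ : ℝ) : Prop :=
  0 < ε₁ ∧ (∀ c, ε₁ ≤ γ * ρ c * r c - (Fintype.card N : ℝ) * qM) ∧
    ε₁ ≤ (γ * ε * (qM - G.muM) - (2 * (Fintype.card N : ℝ) - 1 + G.muM ^ 2) / 2) / qM

end

end DelayNet

end

/-! The proof is a drift argument on sample paths. The Lyapunov function is half the sum over `c` of
`(qM - muM) / qM * Us ^ 2 + X ^ 2 + Z ^ 2 + Us / qM * ∑ n, U n ^ 2`. Weighting the squared node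
queues by `Us / qM` makes its drift contain exactly the weighted sum of the schedule, and the
remaining terms in `R` form, up to `V * R`, the objective of the congestion controller
(`flowLyapunov_succ_sub_le`). The drift constants are finite because the scheduler serves only
positive weights, which keeps every node queue below `qM` (`SuboptimalRun.U_le`).

Two comparisons follow. The controller does at least as well as the constant rate `γ * r c`. The
scheduler reaches `γ` times the max-weight value, which in turn dominates the rate vector `r + ε` of
the capacity region (`sum_capacity_le`). The latter needs no stationary randomized policy: with the
current queues frozen, the weighted sum is a linear functional, and a bound on it over all feasible
schedules passes to the capacity region by averaging any stabilizing run
(`sum_mul_le_of_mem_capacityRegion`).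

The slacks in `ε`, `ρ` and `a` then leave the drift at most `B + V * ∑ R - δ * ∑ (Us + X + Z) - V *
γ * ∑ r`. Telescoping and taking expectations gives one inequality for every `t`: bounding the
inputs yields the queue bound, dropping the nonnegative queues yields the throughput. -/

namespace DelayNet

open Finset

/-! ### Feasible schedules, their weighted sums and max-weight matchings -/

section Schedules

variable {N F : Type*} [Fintype N] [Fintype F] {G : Network N F} {μ : Schedule N F}

theorem Network.Feasible.apply_inl_src (h : G.Feasible μ) (m : N) (c : F) :
    μ (Sum.inl m) (G.src c) c = 0 :=
  (Finset.sum_eq_zero_iff.1 (h.no_return c)) m (mem_univ m)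

theorem Network.Feasible.sum_inr_of_ne (h : G.Feasible μ) {n : N} {c : F} (hn : n ≠ G.src c) :
    ∑ c' : F, μ (Sum.inr c') n c = 0 :=
  Finset.sum_eq_zero fun _ _ => h.supported _ _ _ fun hl => hn hl.2

theorem Network.Feasible.sum_inr_src (h : G.Feasible μ) (c : F) :
    ∑ c' : F, μ (Sum.inr c') (G.src c) c = G.admitted μ c :=
  Finset.sum_eq_single c (fun _ _ hc => h.supported _ _ _ fun hl => hc hl.1) (by simp)

theorem inRate_eq (μ : Schedule N F) (n : N) (c : F) :
    inRate μ n c = ∑ m : N, μ (Sum.inl m) n c + ∑ c' : F, μ (Sum.inr c') n c :=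
  Fintype.sum_sum_type _

theorem Network.Feasible.inRate_src (h : G.Feasible μ) (c : F) :
    inRate μ (G.src c) c = G.admitted μ c := by
  rw [inRate_eq, h.no_return, h.sum_inr_src, zero_add]

theorem Network.Feasible.inRate_of_ne (h : G.Feasible μ) {n : N} {c : F} (hn : n ≠ G.src c) :
    inRate μ n c = ∑ m : N, μ (Sum.inl m) n c := by
  rw [inRate_eq, h.sum_inr_of_ne hn, add_zero]

theorem Network.Feasible.out_add_in_le_one (h : G.Feasible μ) (n : N) (c : F) :
    outRate μ n c + ∑ m : N, μ (Sum.inl m) n c ≤ 1 :=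
  (Finset.single_le_sum
    (f := fun c => ∑ i : N, μ (Sum.inl n) i c + ∑ j : N, μ (Sum.inl j) n c)
    (fun _ _ => Nat.zero_le _) (mem_univ c)).trans (h.node_exclusive n)

theorem Network.Feasible.inRate_le (h : G.Feasible μ) (n : N) (c : F) :
    (inRate μ n c : ℝ) ≤ G.muM := by
  by_cases hn : n = G.src c
  · subst hn
    rw [h.inRate_src]
    exact h.admitted_le c
  · rw [h.inRate_of_ne hn]
    have h1 : ∑ m : N, μ (Sum.inl m) n c ≤ 1 := by
      have := h.out_add_in_le_one n c
      omega
    exact le_trans (by exact_mod_cast h1) G.one_le_muM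

/-- A bound on the sum of the squared service and arrival rates of a flow. -/
theorem Network.Feasible.sum_sq_rates_le (h : G.Feasible μ) (c : F) :
    ∑ n, ((outRate μ n c : ℝ) ^ 2 + (inRate μ n c : ℝ) ^ 2) ≤
      2 * (Fintype.card N : ℝ) - 1 + G.muM ^ 2 := by
  classical
  have hsrc : (outRate μ (G.src c) c : ℝ) ^ 2 + (inRate μ (G.src c) c : ℝ) ^ 2 ≤
      1 + G.muM ^ 2 := by
    have h1 : outRate μ (G.src c) c ≤ 1 := by
      have := h.out_add_in_le_one (G.src c) c
      omega
    have h1' : (outRate μ (G.src c) c : ℝ) ≤ 1 := by exact_mod_cast h1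
    have h2 := h.inRate_le (G.src c) c
    gcongr
    exact pow_le_one₀ (Nat.cast_nonneg _) h1'
  -- Node exclusivity would even give 1 here; the cruder 2 produces the constant `1 + 2 * (N - 1) =
  -- 2 * N - 1`.
  have hother : ∀ n ∈ univ.erase (G.src c),
      (outRate μ n c : ℝ) ^ 2 + (inRate μ n c : ℝ) ^ 2 ≤ 2 := by
    intro n hn
    have h1 := h.out_add_in_le_one n c
    rw [← h.inRate_of_ne (Finset.ne_of_mem_erase hn)] at h1
    have h2 : (outRate μ n c : ℝ) ≤ 1 := by
      have : outRate μ n c ≤ 1 := by omega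
      exact_mod_cast this
    have h3 : (inRate μ n c : ℝ) ≤ 1 := by
      have : inRate μ n c ≤ 1 := by omega
      exact_mod_cast this
    have h4 := pow_le_one₀ (n := 2) (Nat.cast_nonneg _) h2
    have h5 := pow_le_one₀ (n := 2) (Nat.cast_nonneg _) h3
    linarith
  have hcard : ((univ.erase (G.src c)).card : ℝ) = (Fintype.card N : ℝ) - 1 := by
    rw [Finset.card_erase_of_mem (mem_univ _), Finset.card_univ,
      Nat.cast_sub (Fintype.card_pos_iff.2 ⟨G.src c⟩), Nat.cast_one]
  calc ∑ n, ((outRate μ n c : ℝ) ^ 2 + (inRate μ n c : ℝ) ^ 2)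
      = ((outRate μ (G.src c) c : ℝ) ^ 2 + (inRate μ (G.src c) c : ℝ) ^ 2) +
        ∑ n ∈ univ.erase (G.src c), ((outRate μ n c : ℝ) ^ 2 + (inRate μ n c : ℝ) ^ 2) :=
        (Finset.add_sum_erase _ _ (mem_univ _)).symm
    _ ≤ (1 + G.muM ^ 2) + ∑ n ∈ univ.erase (G.src c), (2 : ℝ) :=
        add_le_add hsrc (Finset.sum_le_sum hother)
    _ = 2 * (Fintype.card N : ℝ) - 1 + G.muM ^ 2 := by
        rw [Finset.sum_const, nsmul_eq_mul, hcard]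
        ring

/-- The weighted sum of a feasible schedule, rearranged by nodes. -/
theorem Network.Feasible.sum_mul_weight (h : G.Feasible μ) (qM : ℝ) (U : N → F → ℕ)
    (Us : F → ℝ) :
    ∑ u : N ⊕ F, ∑ n : N, ∑ c : F, (μ u n c : ℝ) * G.weight qM U Us u n c =
      ∑ c : F, Us c / qM *
        (∑ n : N, (U n c : ℝ) * ((outRate μ n c : ℝ) - (inRate μ n c : ℝ)) +
          (qM - G.muM) * (G.admitted μ c : ℝ)) := by
  have hswap : ∑ u : N ⊕ F, ∑ n : N, ∑ c : F, (μ u n c : ℝ) * G.weight qM U Us u n c =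
      ∑ c : F, ∑ u : N ⊕ F, ∑ n : N, (μ u n c : ℝ) * G.weight qM U Us u n c := by
    exact (Finset.sum_congr rfl fun u _ => Finset.sum_comm).trans Finset.sum_comm
  rw [hswap]
  refine Finset.sum_congr rfl fun c _ => ?_
  -- Where the weight is 0 by convention, a feasible rate vanishes as well, so the backlog formula
  -- holds on every pair.
  have hl : ∀ m n, (μ (Sum.inl m) n c : ℝ) * G.weight qM U Us (Sum.inl m) n c =
      Us c / qM * ((U m c : ℝ) * (μ (Sum.inl m) n c : ℝ) -
        (U n c : ℝ) * (μ (Sum.inl m) n c : ℝ)) := by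
    intro m n
    dsimp only [Network.weight]
    split_ifs with hc
    · ring
    · have h0 : μ (Sum.inl m) n c = 0 := by
        by_cases hn : n = G.src c
        · subst hn
          exact h.apply_inl_src m c
        · exact h.supported _ _ _ fun hl => hc ⟨hl, hn⟩
      simp [h0]
  have hr : ∀ c' n, (μ (Sum.inr c') n c : ℝ) * G.weight qM U Us (Sum.inr c') n c =
      Us c / qM * ((qM - G.muM) * (μ (Sum.inr c') n c : ℝ) -
        (U n c : ℝ) * (μ (Sum.inr c') n c : ℝ)) := by
    intro c' n
    dsimp only [Network.weight]
    split_ifs with hc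
    · rw [hc.2]
      ring
    · simp [h.supported (Sum.inr c') n c hc]
  have hadm : ∑ n : N, ∑ c' : F, (μ (Sum.inr c') n c : ℝ) = (G.admitted μ c : ℝ) := by
    rw [Finset.sum_eq_single (G.src c)]
    · exact_mod_cast h.sum_inr_src c
    · intro n _ hn
      exact_mod_cast h.sum_inr_of_ne hn
    · simp
  rw [Fintype.sum_sum_type]
  simp_rw [hl, hr, ← Finset.mul_sum]
  rw [← mul_add]
  congr 1
  have hin : ∀ n, (inRate μ n c : ℝ) =
      ∑ m : N, (μ (Sum.inl m) n c : ℝ) + ∑ c' : F, (μ (Sum.inr c') n c : ℝ) := by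
    intro n
    rw [inRate_eq]
    push_cast
    rfl
  have hout : ∀ n, (outRate μ n c : ℝ) = ∑ i : N, (μ (Sum.inl n) i c : ℝ) := by
    intro n
    unfold outRate
    push_cast
    rfl
  rw [← hadm]
  simp_rw [hin, hout, Finset.sum_sub_distrib, ← Finset.mul_sum, mul_sub, mul_add,
    Finset.sum_sub_distrib, Finset.sum_add_distrib]
  rw [Finset.sum_comm (f := fun m n => (U n c : ℝ) * (μ (Sum.inl m) n c : ℝ)),
    Finset.sum_comm (f := fun c' n => (U n c : ℝ) * (μ (Sum.inr c') n c : ℝ)),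
    Finset.sum_comm (f := fun c' n => (μ (Sum.inr c') n c : ℝ))]
  simp_rw [← Finset.mul_sum]
  ring

open Classical in
/-- All rates of a pair are handed over to the flow of maximal weight, if this weight is positive. -/
noncomputable def concentrate (w : (N ⊕ F) → N → F → ℝ) (cs : (N ⊕ F) → N → F)
    (μ : Schedule N F) : Schedule N F :=
  fun u n c => if c = cs u n ∧ 0 < w u n c then ∑ c' : F, μ u n c' else 0

theorem sum_concentrate_le {N' F' : Type*} [Fintype F'] (w : (N' ⊕ F') → N' → F' → ℝ)
    (cs : (N' ⊕ F') → N' → F') (μ : Schedule N' F') (u : N' ⊕ F') (n : N') :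
    ∑ c : F', concentrate w cs μ u n c ≤ ∑ c : F', μ u n c := by
  rw [Finset.sum_eq_single (cs u n)]
  · unfold concentrate
    split_ifs
    · exact le_rfl
    · exact Nat.zero_le _
  · intro c _ hc
    simp [concentrate, hc]
  · simp

/-- A positive weight occurs only on admissible pairs that do not lead back to the source, and the
total over flows on each pair does not grow, so every constraint survives the reallocation. -/
theorem Network.Feasible.policyFeasible_concentrate (h : G.Feasible μ) (qM : ℝ)
    (U : N → F → ℕ) (Us : F → ℝ) (cs : (N ⊕ F) → N → F) :
    G.PolicyFeasible cs (concentrate (G.weight qM U Us) cs μ) := by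
  set w := G.weight qM U Us with hw
  have hpos : ∀ u n c, 0 < w u n c → G.extLink c u n := by
    rintro (m | c') n c hc
    · by_contra hl
      have : w (Sum.inl m) n c = 0 := if_neg fun hh => hl hh.1
      linarith
    · by_contra hl
      have : w (Sum.inr c') n c = 0 := if_neg fun hh => hl hh
      linarith
  refine ⟨⟨?_, ?_, ?_, ?_, ?_⟩, ?_⟩
  · intro u n c hl
    exact if_neg fun hh => hl (hpos _ _ _ hh.2)
  · intro m n c
    have h1 : ∑ c' : F, μ (Sum.inl m) n c' ≤ 1 := by
      refine le_trans (Finset.sum_le_sum fun c' _ => ?_) (h.node_exclusive m)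
      exact le_add_right (Finset.single_le_sum (f := fun i => μ (Sum.inl m) i c')
        (fun _ _ => Nat.zero_le _) (mem_univ n))
    exact ((Finset.single_le_sum (f := fun c => concentrate w cs μ (Sum.inl m) n c)
        (fun _ _ => Nat.zero_le _) (mem_univ c)).trans (sum_concentrate_le w cs μ _ n)).trans h1
  · intro c
    have h1 : G.admitted (concentrate w cs μ) c ≤ G.admitted μ c := by
      unfold Network.admitted concentrate
      split_ifs
      -- A transport-layer source carries only its own flow, so nothing is added to its admissions.
      · rw [Finset.sum_eq_single c]
        · intro c' _ hc
          exact h.supported _ _ _ fun hl => hc hl.1.symm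
        · simp
      · exact Nat.zero_le _
    exact le_trans (by exact_mod_cast h1) (h.admitted_le c)
  · intro c
    refine Finset.sum_eq_zero fun m _ => if_neg fun hh => ?_
    have : w (Sum.inl m) (G.src c) c = 0 := if_neg fun hh => hh.2 rfl
    linarith [hh.2]
  · intro n
    have h1 := h.node_exclusive n
    rw [Finset.sum_add_distrib, Finset.sum_comm, Finset.sum_comm (t := (univ : Finset N))] at h1 ⊢
    exact le_trans (add_le_add (Finset.sum_le_sum fun i _ => sum_concentrate_le w cs μ _ i)
      (Finset.sum_le_sum fun j _ => sum_concentrate_le w cs μ _ n)) h1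
  · intro u n c hc
    exact if_neg fun hh => hc hh.1

theorem sum_mul_le_totalWeight_concentrate {w : (N ⊕ F) → N → F → ℝ} {cs : (N ⊕ F) → N → F}
    (hcs : IsArgmax w cs) (μ : Schedule N F) :
    ∑ u : N ⊕ F, ∑ n : N, ∑ c : F, (μ u n c : ℝ) * w u n c ≤
      totalWeight w cs (concentrate w cs μ) := by
  refine Finset.sum_le_sum fun u _ => Finset.sum_le_sum fun n _ => ?_
  by_cases hw : 0 < w u n (cs u n)
  · have h1 : concentrate w cs μ u n (cs u n) = ∑ c : F, μ u n c := if_pos ⟨rfl, hw⟩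
    rw [h1, Nat.cast_sum, Finset.sum_mul]
    exact Finset.sum_le_sum fun c _ => mul_le_mul_of_nonneg_left
      ((hcs u n c).trans (le_max_left _ _)) (Nat.cast_nonneg _)
  · have h1 : pairWeight w cs u n = 0 := max_eq_right (not_lt.1 hw)
    rw [h1, mul_zero]
    exact Finset.sum_nonpos fun c _ =>
      mul_nonpos_of_nonneg_of_nonpos (Nat.cast_nonneg _) ((hcs u n c).trans (not_lt.1 hw))

/-- A max-weight matching dominates every feasible schedule. -/
theorem Network.IsMaxWeight.sum_mul_le {qM : ℝ} {U : N → F → ℕ} {Us : F → ℝ}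
    {cs : (N ⊕ F) → N → F} {opt : Schedule N F}
    (hopt : G.IsMaxWeight (G.weight qM U Us) cs opt) (hcs : IsArgmax (G.weight qM U Us) cs)
    (h : G.Feasible μ) :
    ∑ u : N ⊕ F, ∑ n : N, ∑ c : F, (μ u n c : ℝ) * G.weight qM U Us u n c ≤
      totalWeight (G.weight qM U Us) cs opt :=
  (sum_mul_le_totalWeight_concentrate hcs μ).trans
    (hopt.2 _ (h.policyFeasible_concentrate qM U Us cs))

/-- The positive part in `pairWeight` is harmless because `hz` idles every pair whose maximal weight
is not positive. -/
theorem totalWeight_eq_sum {w : (N ⊕ F) → N → F → ℝ} {cs : (N ⊕ F) → N → F}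
    (h0 : ∀ u n c, c ≠ cs u n → μ u n c = 0)
    (hz : ∀ u n, pairWeight w cs u n = 0 → ∀ c, μ u n c = 0) :
    totalWeight w cs μ = ∑ u : N ⊕ F, ∑ n : N, ∑ c : F, (μ u n c : ℝ) * w u n c := by
  refine Finset.sum_congr rfl fun u _ => Finset.sum_congr rfl fun n _ => ?_
  rw [Finset.sum_eq_single (cs u n)]
  · rcases le_total (w u n (cs u n)) 0 with hw | hw
    · simp [hz u n (max_eq_right hw)]
    · rw [pairWeight, max_eq_left hw]
  · intro c _ hc
    simp [h0 u n c hc]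
  · simp

end Schedules

/-! ### Linear inequalities valid on the capacity region -/

section Capacity

variable {N F : Type*} [Fintype N] [Fintype F] {G : Network N F}

/-- A sequence with bounded time averages is not eventually above a linear function. -/
theorem not_eventually_linear_le_of_sum_le {f : ℕ → ℝ} (hf : ∀ t, 0 ≤ f t) {C η : ℝ} (hη : 0 < η)
    (hsum : ∀ᶠ t : ℕ in atTop, ∑ τ ∈ range t, f τ ≤ C * t) :
    ¬ ∀ᶠ t : ℕ in atTop, η * t ≤ f t := by
  intro h
  obtain ⟨T, hT⟩ := eventually_atTop.1 (hsum.and h)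
  -- The terms with index in `[s, 2s)` alone sum to at least `η * s ^ 2`, against the bound `2 * C *
  -- s`; this is absurd once `η * s > 2 * C`.
  obtain ⟨s, hs⟩ := exists_nat_gt (2 * C / η + T)
  have hTs : T ≤ s := by
    by_contra hlt
    have h1 : (s : ℝ) ≤ T := by exact_mod_cast (not_le.1 hlt).le
    have h2 := (hT T le_rfl).1
    have h3 : 0 ≤ C * T := (Finset.sum_nonneg fun τ _ => hf τ).trans h2
    have hTpos : (0 : ℝ) < T := by
      have : 0 < T := by omega
      exact_mod_cast this
    have h4 : 0 ≤ C := nonneg_of_mul_nonneg_left h3 hTpos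
    have : 0 ≤ 2 * C / η := by positivity
    linarith
  have hs2 : 2 * C < η * s := by
    have : 2 * C / η < s := by
      have : (0 : ℝ) ≤ T := Nat.cast_nonneg _
      linarith
    rw [div_lt_iff₀ hη] at this
    linarith
  have hspos : (0 : ℝ) < s := by
    rcases Nat.eq_zero_or_pos s with h0 | h0
    · have h2 := (hT 1 (by omega)).1
      have h3 : 0 ≤ C * (1 : ℕ) := (Finset.sum_nonneg fun τ _ => hf τ).trans h2
      subst h0
      push_cast at h3 hs2
      linarith
    · exact_mod_cast h0
  have hle : (s : ℝ) * (η * s) ≤ ∑ τ ∈ range (2 * s), f τ := by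
    calc (s : ℝ) * (η * s) = ∑ τ ∈ range (2 * s) \ range s, η * s := by
          rw [Finset.sum_const, nsmul_eq_mul,
            Finset.card_sdiff_of_subset (Finset.range_subset_range.2 (by omega)),
            Finset.card_range, Finset.card_range]
          congr 2
          omega
      _ ≤ ∑ τ ∈ range (2 * s) \ range s, f τ := by
          refine Finset.sum_le_sum fun τ hτ => ?_
          have hsτ : s ≤ τ := by
            simp only [Finset.mem_sdiff, Finset.mem_range] at hτ
            omega
          refine le_trans ?_ (hT τ (hTs.trans hsτ)).2
          gcongr
      _ ≤ _ := Finset.sum_le_sum_of_subset_of_nonneg Finset.sdiff_subset fun τ _ _ => hf τ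
  have h5 := (hT (2 * s) (by omega)).1
  push_cast at h5
  nlinarith

namespace Network.OpenLoopRun

variable {Ω : Type*} [MeasurableSpace Ω] {P : Measure Ω} (S : G.OpenLoopRun P)

theorem U_le (t : ℕ) (ω : Ω) (n : N) (c : F) : (S.U t ω n c : ℝ) ≤ t * G.muM := by
  have hmu : 0 ≤ G.muM := zero_le_one.trans G.one_le_muM
  induction t with
  | zero => simp [S.U_zero]
  | succ t ih =>
    by_cases hn : n = G.dst c
    · subst hn
      rw [S.U_dst]
      simp only [Nat.cast_zero]
      positivity
    · rw [S.U_succ t ω n c hn]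
      have h1 := (S.feasible t ω).inRate_le n c
      have h2 : ((S.U t ω n c - outRate (S.rate t ω) n c : ℕ) : ℝ) ≤ S.U t ω n c := by
        exact_mod_cast Nat.sub_le _ _
      push_cast at h2 ⊢
      linarith

theorem integrable_U [IsFiniteMeasure P] (t : ℕ) (n : N) (c : F) :
    Integrable (fun ω => (S.U t ω n c : ℝ)) P := by
  refine Integrable.of_bound
    (measurable_from_nat.comp (S.measurable_U t n c)).aestronglyMeasurable (t * G.muM)
    (Eventually.of_forall fun ω => ?_)
  rw [Real.norm_of_nonneg (Nat.cast_nonneg _)]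
  exact S.U_le t ω n c

theorem integrable_admitted [IsFiniteMeasure P] (t : ℕ) (c : F) :
    Integrable (fun ω => (G.admitted (S.rate t ω) c : ℝ)) P := by
  refine Integrable.of_bound
    (measurable_from_nat.comp (S.measurable_rate t _ _ _)).aestronglyMeasurable G.muM
    (Eventually.of_forall fun ω => ?_)
  rw [Real.norm_of_nonneg (Nat.cast_nonneg _)]
  exact (S.feasible t ω).admitted_le c

theorem Stable.exists_sum_le [IsFiniteMeasure P] {S : G.OpenLoopRun P} (hS : S.Stable) (n : N)
    (c : F) : ∃ C : ℝ, ∀ᶠ t : ℕ in atTop,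
      ∑ τ ∈ range t, ∫ ω, (S.U τ ω n c : ℝ) ∂P ≤ C * t := by
  obtain ⟨C, hC, hC'⟩ := exists_between (hS n c)
  refine ⟨C.toReal, ?_⟩
  filter_upwards [eventually_lt_of_limsup_lt hC, eventually_gt_atTop 0] with t ht ht0
  have h1 : ∀ τ, ∫⁻ ω, (S.U τ ω n c : ENNReal) ∂P =
      ENNReal.ofReal (∫ ω, (S.U τ ω n c : ℝ) ∂P) := by
    intro τ
    rw [ofReal_integral_eq_lintegral_ofReal (S.integrable_U τ n c)
      (Eventually.of_forall fun ω => Nat.cast_nonneg _)]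
    simp
  simp_rw [h1] at ht
  rw [← ENNReal.ofReal_sum_of_nonneg fun τ _ => integral_nonneg fun ω => Nat.cast_nonneg _] at ht
  have h2 := (ENNReal.div_le_iff (by simpa using ht0.ne') (by simp)).1 ht.le
  have h3 := ENNReal.toReal_mono (ENNReal.mul_ne_top hC'.ne (by simp)) h2
  rwa [ENNReal.toReal_ofReal (Finset.sum_nonneg fun τ _ => integral_nonneg fun ω =>
    Nat.cast_nonneg _), ENNReal.toReal_mul, ENNReal.toReal_natCast] at h3

theorem exists_weighted_sum_le [IsFiniteMeasure P] {S : G.OpenLoopRun P} (hS : S.Stable)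
    {b : N → F → ℝ} (hb : ∀ n c, 0 ≤ b n c) : ∃ C : ℝ, ∀ᶠ t : ℕ in atTop,
      ∑ τ ∈ range t, ∑ c, ∑ n, b n c * ∫ ω, (S.U τ ω n c : ℝ) ∂P ≤ C * t := by
  choose C hC using fun n c => Stable.exists_sum_le hS n c
  refine ⟨∑ c, ∑ n, b n c * C n c, ?_⟩
  filter_upwards [eventually_all.2 fun n => eventually_all.2 fun c => hC n c] with t ht
  rw [Finset.sum_comm, Finset.sum_mul]
  refine Finset.sum_le_sum fun c _ => ?_
  rw [Finset.sum_comm, Finset.sum_mul]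
  refine Finset.sum_le_sum fun n _ => ?_
  rw [← Finset.mul_sum, mul_assoc]
  exact mul_le_mul_of_nonneg_left (ht n c) (hb n c)

theorem out_sub_in (t : ℕ) (ω : Ω) {n : N} {c : F} (hn : n ≠ G.dst c) :
    (outRate (S.rate t ω) n c : ℝ) - (inRate (S.rate t ω) n c : ℝ) =
      (S.U t ω n c : ℝ) - (S.U (t + 1) ω n c : ℝ) := by
  rw [S.U_succ t ω n c hn, Nat.cast_add, Nat.cast_sub (S.sent_le t ω n c)]
  ring

/-- A linear bound on all feasible schedules, summed over time and averaged. -/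
theorem sum_integral_admitted_le [IsProbabilityMeasure P] {b : N → F → ℝ}
    (hdst : ∀ c, b (G.dst c) c = 0) {k : F → ℝ} {M : ℝ}
    (hM : ∀ μ : Schedule N F, G.Feasible μ →
      ∑ c, ((∑ n, b n c * ((outRate μ n c : ℝ) - (inRate μ n c : ℝ))) +
        k c * (G.admitted μ c : ℝ)) ≤ M) (t : ℕ) :
    ∑ c, k c * ∑ τ ∈ range t, ∫ ω, (G.admitted (S.rate τ ω) c : ℝ) ∂P ≤
      M * t + ∑ c, ∑ n, b n c * ∫ ω, (S.U t ω n c : ℝ) ∂P := by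
  have hpath : ∀ ω, ∑ c, k c * ∑ τ ∈ range t, (G.admitted (S.rate τ ω) c : ℝ) ≤
      M * t + ∑ c, ∑ n, b n c * (S.U t ω n c : ℝ) := by
    intro ω
    induction t with
    | zero => simp [S.U_zero]
    | succ t ih =>
      have h1 := hM _ (S.feasible t ω)
      -- The exact packet balance makes the node terms telescope in time; the destination, where no
      -- balance holds, is removed by `hdst`.
      have h2 : ∀ c, ∑ n, b n c *
          ((outRate (S.rate t ω) n c : ℝ) - (inRate (S.rate t ω) n c : ℝ)) =
          ∑ n, b n c * (S.U t ω n c : ℝ) - ∑ n, b n c * (S.U (t + 1) ω n c : ℝ) := by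
        intro c
        rw [← Finset.sum_sub_distrib]
        refine Finset.sum_congr rfl fun n _ => ?_
        by_cases hn : n = G.dst c
        · subst hn
          simp [hdst]
        · rw [S.out_sub_in t ω hn, mul_sub]
      simp_rw [h2, Finset.sum_add_distrib, Finset.sum_sub_distrib] at h1
      simp_rw [Finset.sum_range_succ, mul_add, Finset.sum_add_distrib]
      push_cast
      linarith
  have hi1 : ∀ c ∈ (univ : Finset F), Integrable
      (fun ω => k c * ∑ τ ∈ range t, (G.admitted (S.rate τ ω) c : ℝ)) P := fun c _ =>
    (integrable_finsetSum _ fun τ _ => S.integrable_admitted τ c).const_mul _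
  have hi3 : ∀ c, ∀ n ∈ (univ : Finset N), Integrable
      (fun ω => b n c * (S.U t ω n c : ℝ)) P := fun c n _ =>
    (S.integrable_U t n c).const_mul _
  have hi2 : ∀ c ∈ (univ : Finset F), Integrable
      (fun ω => ∑ n, b n c * (S.U t ω n c : ℝ)) P := fun c _ =>
    integrable_finsetSum _ (hi3 c)
  have h := integral_mono (integrable_finsetSum _ hi1)
    ((integrable_const (M * t)).add (integrable_finsetSum _ hi2)) hpath
  rw [integral_finsetSum _ hi1, integral_add' (integrable_const _) (integrable_finsetSum _ hi2),
    integral_finsetSum _ hi2, integral_const, probReal_univ, one_smul] at h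
  simp_rw [fun c => integral_finsetSum _ (hi3 c), integral_const_mul,
    fun c => integral_finsetSum (range t) (fun τ _ => S.integrable_admitted τ c)] at h
  exact h

end Network.OpenLoopRun

/-- A linear bound on all feasible schedules passes to the capacity region: there the net flow out
of every node but the destination vanishes. -/
theorem Network.sum_mul_le_of_mem_capacityRegion {z : F → ℝ} (hz : z ∈ G.capacityRegion)
    {b : N → F → ℝ} (hb : ∀ n c, 0 ≤ b n c) (hdst : ∀ c, b (G.dst c) c = 0) {k : F → ℝ} {M : ℝ}
    (hM : ∀ μ : Schedule N F, G.Feasible μ →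
      ∑ c, ((∑ n, b n c * ((outRate μ n c : ℝ) - (inRate μ n c : ℝ))) +
        k c * (G.admitted μ c : ℝ)) ≤ M) :
    ∑ c, k c * z c ≤ M := by
  obtain ⟨Ω, _, P, _, S, hrate, hstable⟩ := hz
  by_contra! hlt
  -- Weighted admissions eventually exceed `y * t`, so the weighted mean backlog is at least `(y -
  -- M) * t` for all large `t`, contradicting stability.
  obtain ⟨y, hMy, hyz⟩ := exists_between hlt
  obtain ⟨C, hC⟩ := Network.OpenLoopRun.exists_weighted_sum_le hstable hb
  have hlim : Tendsto (fun t : ℕ => ∑ c, k c *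
      ((∑ τ ∈ range t, ∫ ω, (G.admitted (S.rate τ ω) c : ℝ) ∂P) / (t : ℝ))) atTop
      (nhds (∑ c, k c * z c)) :=
    tendsto_finsetSum _ fun c _ => (hrate c).const_mul (k c)
  refine not_eventually_linear_le_of_sum_le (fun t => Finset.sum_nonneg fun c _ =>
    Finset.sum_nonneg fun n _ => mul_nonneg (hb n c) (integral_nonneg fun ω =>
      Nat.cast_nonneg _)) (sub_pos.2 hMy) hC ?_
  filter_upwards [hlim.eventually (lt_mem_nhds hyz), eventually_gt_atTop 0] with t ht ht0
  have ht0' : (0 : ℝ) < t := by exact_mod_cast ht0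
  have h1 := S.sum_integral_admitted_le hdst hM t
  simp_rw [← mul_div_assoc, ← Finset.sum_div] at ht
  rw [lt_div_iff₀ ht0'] at ht
  linarith

/-- The case `b = 0` of the previous bound. It makes `γ * r c` an admissible comparison rate for the
congestion controller. -/
theorem Network.le_muM_of_mem_capacityRegion {z : F → ℝ} (hz : z ∈ G.capacityRegion) (c : F) :
    z c ≤ G.muM := by
  classical
  have h := G.sum_mul_le_of_mem_capacityRegion hz (b := 0) (k := Pi.single c 1) (M := G.muM)
    (fun _ _ => le_rfl) (fun _ => rfl) fun μ hμ => by
      simpa [Pi.single_apply] using hμ.admitted_le c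
  simpa [Pi.single_apply] using h

end Capacity

/-! ### Squared queue recursion and the congestion controller -/

/-- If `q ≥ o`, expanding the square leaves a spare `-2 * o * i`; otherwise the right side exceeds
`i ^ 2` by `(q - o) ^ 2 + 2 * q * i`. -/
theorem sq_le_of_queue {q q' o i : ℝ} (hq : 0 ≤ q) (ho : 0 ≤ o) (hi : 0 ≤ i) (hq' : 0 ≤ q')
    (h : q' ≤ max (q - o) 0 + i) : q' ^ 2 ≤ q ^ 2 + o ^ 2 + i ^ 2 - 2 * q * (o - i) := by
  refine (pow_le_pow_left₀ hq' h 2).trans ?_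
  rcases le_total (q - o) 0 with hqo | hqo
  · rw [max_eq_right hqo]
    nlinarith [mul_nonneg hq hi, sq_nonneg (q - o)]
  · rw [max_eq_left hqo]
    nlinarith [mul_nonneg ho hi]

theorem Network.muM_nonneg {N F : Type*} (G : Network N F) : 0 ≤ G.muM :=
  zero_le_one.trans G.one_le_muM

section CongestionControl

variable {muM qM V ρ us x z : ℝ}

theorem congestionControl_nonneg (h : 0 ≤ muM) : 0 ≤ congestionControl muM qM V ρ us x z := by
  unfold congestionControl
  split_ifs <;> simp [h]

theorem congestionControl_le (h : 0 ≤ muM) : congestionControl muM qM V ρ us x z ≤ muM := by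
  unfold congestionControl
  split_ifs <;> simp [h]

theorem congestionControl_mul_le {y : ℝ} (h0 : 0 ≤ y) (h1 : y ≤ muM) :
    congestionControl muM qM V ρ us x z * ((qM - muM) / qM * us - x * ρ - z - V) ≤
      y * ((qM - muM) / qM * us - x * ρ - z - V) := by
  unfold congestionControl
  split_ifs with h
  · rw [zero_mul]
    exact mul_nonneg h0 h.le
  · exact mul_le_mul_of_nonpos_right h1 (not_lt.1 h)

theorem integrable_congestionControl {Ω : Type*} [MeasurableSpace Ω] {P : Measure Ω}
    [IsFiniteMeasure P] (h : 0 ≤ muM) {us x z : Ω → ℝ} (hus : Integrable us P)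
    (hx : Integrable x P) (hz : Integrable z P) :
    Integrable (fun ω => congestionControl muM qM V ρ (us ω) (x ω) (z ω)) P := by
  classical
  have hk : AEMeasurable (fun ω => (qM - muM) / qM * us ω - x ω * ρ - z ω - V) P :=
    ((((hus.const_mul _).sub (hx.mul_const ρ)).sub hz).sub (integrable_const V)).aemeasurable
  have hg : Measurable fun y : ℝ => if y > 0 then 0 else muM :=
    Measurable.ite measurableSet_Ioi measurable_const measurable_const
  have hm : AEMeasurable (fun ω => congestionControl muM qM V ρ (us ω) (x ω) (z ω)) P := by
    refine (hg.comp_aemeasurable hk).congr (Eventually.of_forall fun ω => ?_)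
    simp only [Function.comp, congestionControl]
  refine Integrable.of_bound hm.aestronglyMeasurable muM (Eventually.of_forall fun ω => ?_)
  rw [Real.norm_of_nonneg (congestionControl_nonneg h)]
  exact congestionControl_le h

end CongestionControl

/-! ### Deterministic queue bounds and the drift of a single flow -/

section

variable {N F : Type*} [Fintype N] [Fintype F] {G : Network N F} {γ qM V : ℝ} {ρ a : F → ℝ}
  {Ω : Type*} [MeasurableSpace Ω] {P : Measure Ω} (S : G.SuboptimalRun γ qM V ρ a P)

namespace Network.SuboptimalRun

theorem R_nonneg (t : ℕ) (ω : Ω) (c : F) : 0 ≤ S.R t ω c :=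
  congestionControl_nonneg G.muM_nonneg

theorem R_le (t : ℕ) (ω : Ω) (c : F) : S.R t ω c ≤ G.muM :=
  congestionControl_le G.muM_nonneg

theorem Us_nonneg (t : ℕ) (ω : Ω) (c : F) : 0 ≤ S.Us t ω c := by
  cases t with
  | zero => rw [S.Us_zero]
  | succ t =>
    rw [S.Us_succ]
    exact add_nonneg (le_max_right _ _) (S.R_nonneg t ω c)

theorem Z_nonneg (ha : ∀ c, 0 ≤ a c) (t : ℕ) (ω : Ω) (c : F) : 0 ≤ S.Z t ω c := by
  cases t with
  | zero => rw [S.Z_zero]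
  | succ t =>
    rw [S.Z_succ]
    exact add_nonneg (le_max_right _ _) (ha c)

theorem X_nonneg (t : ℕ) (ω : Ω) (c : F) : 0 ≤ S.X t ω c := by
  cases t with
  | zero => rw [S.X_zero]
  | succ t =>
    rw [S.X_succ]
    exact add_nonneg (le_max_right _ _) (Finset.sum_nonneg fun _ _ => Nat.cast_nonneg _)

theorem feasible (t : ℕ) (ω : Ω) : G.Feasible (S.rate t ω) := (S.suboptimal t ω).1.1

/-- This controls the node queues: a served link has a strictly larger backlog at its tail, and an
admission finds more than `muM` of room below `qM`. -/
theorem weight_pos_of_rate_ne_zero {t : ℕ} {ω : Ω} {u : N ⊕ F} {n : N} {c : F}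
    (h : S.rate t ω u n c ≠ 0) : 0 < G.weight qM (S.U t ω) (S.Us t ω) u n c := by
  obtain ⟨⟨_, hcs⟩, hzero, _⟩ := S.suboptimal t ω
  have hc : c = S.cs t ω u n := by
    by_contra hne
    exact h (hcs u n c hne)
  by_contra hw
  refine h (hzero u n (max_eq_right ?_) c)
  rw [← hc]
  exact not_lt.1 hw

/-- The node queues never exceed `qM`. -/
theorem U_le (hqM : G.muM < qM) (t : ℕ) (ω : Ω) (n : N) (c : F) : (S.U t ω n c : ℝ) ≤ qM := by
  have hq : 0 < qM := G.muM_nonneg.trans_lt hqM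
  induction t generalizing n with
  | zero => simp [S.U_zero, hq.le]
  | succ t ih =>
    by_cases hn : n = G.dst c
    · subst hn
      simp [S.U_dst, hq.le]
    have hUs : 0 ≤ S.Us t ω c / qM := div_nonneg (S.Us_nonneg t ω c) hq.le
    have hstep : (S.U (t + 1) ω n c : ℝ) ≤ S.U t ω n c + inRate (S.rate t ω) n c := by
      refine (S.U_succ t ω n c hn).trans (add_le_add_left (max_le ?_ (Nat.cast_nonneg _)) _)
      exact sub_le_self _ (Nat.cast_nonneg _)
    have hf := S.feasible t ω
    by_cases hsrc : n = G.src c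
    · subst hsrc
      rw [hf.inRate_src] at hstep
      by_cases h0 : S.rate t ω (Sum.inr c) (G.src c) c = 0
      · simp only [Network.admitted, h0, Nat.cast_zero, add_zero] at hstep
        exact hstep.trans (ih _)
      · have hw := S.weight_pos_of_rate_ne_zero h0
        simp only [Network.weight, and_self, if_true] at hw
        have := pos_of_mul_pos_right hw hUs
        have := hf.admitted_le c
        linarith
    · rw [hf.inRate_of_ne hsrc] at hstep
      by_cases h0 : ∑ m : N, S.rate t ω (Sum.inl m) n c = 0
      · rw [h0, Nat.cast_zero, add_zero] at hstep
        exact hstep.trans (ih _)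
      · obtain ⟨m, _, hm⟩ := Finset.exists_ne_zero_of_sum_ne_zero h0
        have hw := S.weight_pos_of_rate_ne_zero hm
        have hl : G.link m n := by
          by_contra hl
          exact hm (hf.supported _ _ _ hl)
        simp only [Network.weight, hl, ne_eq, hsrc, not_false_eq_true, and_self, if_true] at hw
        have h1 := pos_of_mul_pos_right hw hUs
        -- Integrality turns the strict difference into a gap of one packet, which absorbs the
        -- single possible arrival.
        have h2 : S.U t ω n c + 1 ≤ S.U t ω m c := by
          have h3 : (S.U t ω n c : ℝ) < S.U t ω m c := by linarith
          exact_mod_cast h3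
        have h3 : (S.U t ω n c : ℝ) + 1 ≤ S.U t ω m c := by exact_mod_cast h2
        have h4 : ((∑ m : N, S.rate t ω (Sum.inl m) n c : ℕ) : ℝ) ≤ 1 := by
          have := hf.out_add_in_le_one n c
          have h5 : ∑ m : N, S.rate t ω (Sum.inl m) n c ≤ 1 := by omega
          exact_mod_cast h5
        linarith [ih m]

theorem integrable_U [IsFiniteMeasure P] (hqM : G.muM < qM) (t : ℕ) (n : N) (c : F) :
    Integrable (fun ω => (S.U t ω n c : ℝ)) P := by
  refine Integrable.of_bound
    (measurable_from_nat.comp (S.measurable_U t n c)).aestronglyMeasurable qM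
    (Eventually.of_forall fun ω => ?_)
  rw [Real.norm_of_nonneg (Nat.cast_nonneg _)]
  exact S.U_le hqM t ω n c

theorem integrable_admitted [IsFiniteMeasure P] (t : ℕ) (c : F) :
    Integrable (fun ω => (G.admitted (S.rate t ω) c : ℝ)) P := by
  refine Integrable.of_bound
    (measurable_from_nat.comp (S.measurable_rate t _ _ _)).aestronglyMeasurable G.muM
    (Eventually.of_forall fun ω => ?_)
  rw [Real.norm_of_nonneg (Nat.cast_nonneg _)]
  exact (S.feasible t ω).admitted_le c

theorem integrable_virtual [IsFiniteMeasure P] (hqM : G.muM < qM) (t : ℕ) (c : F) :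
    Integrable (fun ω => S.Us t ω c) P ∧ Integrable (fun ω => S.X t ω c) P ∧
      Integrable (fun ω => S.Z t ω c) P := by
  induction t with
  | zero => simp [S.Us_zero, S.X_zero, S.Z_zero]
  | succ t ih =>
    obtain ⟨hUs, hX, hZ⟩ := ih
    have hR := integrable_congestionControl (qM := qM) (V := V) (ρ := ρ c) G.muM_nonneg hUs hX hZ
    simp_rw [S.Us_succ, S.X_succ, S.Z_succ]
    exact ⟨(hUs.sub (S.integrable_admitted t c)).pos_part.add hR,
      (hX.sub (hR.const_mul _)).pos_part.add
        (integrable_finsetSum _ fun n _ => S.integrable_U hqM t n c),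
      (hZ.sub hR).pos_part.add (integrable_const _)⟩

theorem integrable_R [IsFiniteMeasure P] (hqM : G.muM < qM) (t : ℕ) (c : F) :
    Integrable (fun ω => S.R t ω c) P :=
  integrable_congestionControl G.muM_nonneg (S.integrable_virtual hqM t c).1
    (S.integrable_virtual hqM t c).2.1 (S.integrable_virtual hqM t c).2.2

/-- The part of flow `c` in the Lyapunov function. -/
noncomputable def flowLyapunov (t : ℕ) (ω : Ω) (c : F) : ℝ :=
  ((qM - G.muM) / qM * S.Us t ω c ^ 2 + S.X t ω c ^ 2 + S.Z t ω c ^ 2 +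
    (∑ n, (S.U t ω n c : ℝ) ^ 2) * S.Us t ω c / qM) / 2

theorem flowLyapunov_nonneg (hqM : G.muM < qM) (t : ℕ) (ω : Ω) (c : F) :
    0 ≤ S.flowLyapunov t ω c := by
  have hq : 0 < qM := G.muM_nonneg.trans_lt hqM
  have h1 := S.Us_nonneg t ω c
  have h2 : 0 ≤ qM - G.muM := sub_nonneg.2 hqM.le
  unfold flowLyapunov
  positivity

theorem flowLyapunov_zero (ω : Ω) (c : F) : S.flowLyapunov 0 ω c = 0 := by
  simp [flowLyapunov, S.Us_zero, S.X_zero, S.Z_zero]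

theorem sum_sq_U_succ_le (t : ℕ) (ω : Ω) (c : F) :
    ∑ n, (S.U (t + 1) ω n c : ℝ) ^ 2 ≤ ∑ n, (S.U t ω n c : ℝ) ^ 2 +
      (2 * (Fintype.card N : ℝ) - 1 + G.muM ^ 2) - 2 * ∑ n, (S.U t ω n c : ℝ) *
        ((outRate (S.rate t ω) n c : ℝ) - (inRate (S.rate t ω) n c : ℝ)) := by
  have h : ∀ n ∈ (univ : Finset N), (S.U (t + 1) ω n c : ℝ) ^ 2 ≤ (S.U t ω n c : ℝ) ^ 2 +
      ((outRate (S.rate t ω) n c : ℝ) ^ 2 + (inRate (S.rate t ω) n c : ℝ) ^ 2) -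
      2 * ((S.U t ω n c : ℝ) *
        ((outRate (S.rate t ω) n c : ℝ) - (inRate (S.rate t ω) n c : ℝ))) := by
    intro n _
    by_cases hn : n = G.dst c
    · subst hn
      simp only [S.U_dst, Nat.cast_zero, zero_mul, mul_zero, sub_zero]
      have h1 := sq_nonneg (outRate (S.rate t ω) (G.dst c) c : ℝ)
      have h2 := sq_nonneg (inRate (S.rate t ω) (G.dst c) c : ℝ)
      linarith
    · have := sq_le_of_queue (Nat.cast_nonneg _) (Nat.cast_nonneg _) (Nat.cast_nonneg _)
        (Nat.cast_nonneg _) (S.U_succ t ω n c hn)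
      linarith
  have h1 := Finset.sum_le_sum h
  rw [Finset.sum_sub_distrib, Finset.sum_add_distrib, ← Finset.mul_sum] at h1
  linarith [(S.feasible t ω).sum_sq_rates_le c]

/-- The four parts of the Lyapunov function are estimated separately in `k1` to `k4`. The service
terms of `k1` and `k4` combine into the scheduler's weighted sum; adding and subtracting `V * R`
completes the controller's objective. -/
theorem flowLyapunov_succ_sub_le (hqM : G.muM < qM) (hρ : ∀ c, 0 ≤ ρ c) (ha : ∀ c, 0 ≤ a c)
    (t : ℕ) (ω : Ω) (c : F) :
    S.flowLyapunov (t + 1) ω c - S.flowLyapunov t ω c ≤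
      (1 / 2 * (Fintype.card N : ℝ) * qM * G.muM + (qM - G.muM) / qM * G.muM ^ 2
        + 1 / 2 * G.muM ^ 2 * ρ c ^ 2 + 1 / 2 * (Fintype.card N : ℝ) ^ 2 * qM ^ 2
        + 1 / 2 * G.muM ^ 2 + 1 / 2 * a c ^ 2)
      + S.Us t ω c / qM * ((2 * (Fintype.card N : ℝ) - 1 + G.muM ^ 2) / 2)
      - S.Us t ω c / qM * (∑ n, (S.U t ω n c : ℝ) *
          ((outRate (S.rate t ω) n c : ℝ) - (inRate (S.rate t ω) n c : ℝ)) +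
        (qM - G.muM) * (G.admitted (S.rate t ω) c : ℝ))
      + S.R t ω c * ((qM - G.muM) / qM * S.Us t ω c - S.X t ω c * ρ c - S.Z t ω c - V)
      + V * S.R t ω c + (Fintype.card N : ℝ) * qM * S.X t ω c + S.Z t ω c * a c := by
  have hq : 0 < qM := G.muM_nonneg.trans_lt hqM
  have hmu := G.muM_nonneg
  have hUs := S.Us_nonneg t ω c
  have hX := S.X_nonneg t ω c
  have hZ := S.Z_nonneg ha t ω c
  have hR0 := S.R_nonneg t ω c
  have hR1 := S.R_le t ω c
  have hA0 : (0 : ℝ) ≤ G.admitted (S.rate t ω) c := Nat.cast_nonneg _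
  have hA1 := (S.feasible t ω).admitted_le c
  have hUs' := S.Us_nonneg (t + 1) ω c
  have hUsum0 : (0 : ℝ) ≤ ∑ n, (S.U t ω n c : ℝ) := Finset.sum_nonneg fun _ _ => Nat.cast_nonneg _
  have hUsum1 : ∑ n, (S.U t ω n c : ℝ) ≤ (Fintype.card N : ℝ) * qM := by
    have := Finset.sum_le_card_nsmul univ (fun n => (S.U t ω n c : ℝ)) qM
      fun n _ => S.U_le hqM t ω n c
    rwa [nsmul_eq_mul, Finset.card_univ] at this
  have hsq : ∑ n, (S.U (t + 1) ω n c : ℝ) ^ 2 ≤ (Fintype.card N : ℝ) * qM ^ 2 := by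
    have := Finset.sum_le_card_nsmul univ (fun n => (S.U (t + 1) ω n c : ℝ) ^ 2) (qM ^ 2)
      fun n _ => pow_le_pow_left₀ (Nat.cast_nonneg _) (S.U_le hqM (t + 1) ω n c) 2
    rwa [nsmul_eq_mul, Finset.card_univ] at this
  have hUsq := S.sum_sq_U_succ_le t ω c
  have h1 := sq_le_of_queue hUs hA0 hR0 hUs' (S.Us_succ t ω c).le
  have h2 := sq_le_of_queue hX (mul_nonneg (hρ c) hR0) hUsum0 (S.X_nonneg (t + 1) ω c)
    (S.X_succ t ω c).le
  have h3 := sq_le_of_queue hZ hR0 (ha c) (S.Z_nonneg ha (t + 1) ω c) (S.Z_succ t ω c).le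
  have hUsstep : S.Us (t + 1) ω c ≤ S.Us t ω c + G.muM := by
    have : max (S.Us t ω c - (G.admitted (S.rate t ω) c : ℝ)) 0 ≤ S.Us t ω c :=
      max_le (by linarith) hUs
    have := S.Us_succ t ω c
    change _ = _ + S.R t ω c at this
    linarith
  unfold flowLyapunov
  set A : ℝ := (G.admitted (S.rate t ω) c : ℝ)
  set R := S.R t ω c
  set D := 2 * (Fintype.card N : ℝ) - 1 + G.muM ^ 2
  set W := ∑ n, (S.U t ω n c : ℝ) *
    ((outRate (S.rate t ω) n c : ℝ) - (inRate (S.rate t ω) n c : ℝ))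
  set T := ∑ n, (S.U t ω n c : ℝ) ^ 2
  set T' := ∑ n, (S.U (t + 1) ω n c : ℝ) ^ 2
  set Q := ∑ n, (S.U t ω n c : ℝ)
  have hT' : 0 ≤ T' := Finset.sum_nonneg fun _ _ => sq_nonneg _
  have hA2 : A ^ 2 ≤ G.muM ^ 2 := pow_le_pow_left₀ hA0 hA1 2
  have hR2 : R ^ 2 ≤ G.muM ^ 2 := pow_le_pow_left₀ hR0 hR1 2
  have hQ2 : Q ^ 2 ≤ ((Fintype.card N : ℝ) * qM) ^ 2 := pow_le_pow_left₀ hUsum0 hUsum1 2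
  have hθ : 0 ≤ (qM - G.muM) / qM := div_nonneg (sub_nonneg.2 hqM.le) hq.le
  have k1 : (qM - G.muM) / qM * S.Us (t + 1) ω c ^ 2 ≤
      (qM - G.muM) / qM * (S.Us t ω c ^ 2 + 2 * G.muM ^ 2 - 2 * S.Us t ω c * (A - R)) := by
    refine mul_le_mul_of_nonneg_left ?_ hθ
    linarith
  have k2 : S.X (t + 1) ω c ^ 2 ≤ S.X t ω c ^ 2 + ρ c ^ 2 * G.muM ^ 2 +
      ((Fintype.card N : ℝ) * qM) ^ 2 - 2 * S.X t ω c * (ρ c * R - (Fintype.card N : ℝ) * qM) := by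
    have e1 : (ρ c * R) ^ 2 ≤ ρ c ^ 2 * G.muM ^ 2 := by
      rw [mul_pow]
      exact mul_le_mul_of_nonneg_left hR2 (sq_nonneg _)
    have e2 := mul_le_mul_of_nonneg_left hUsum1 hX
    linarith
  have k3 : S.Z (t + 1) ω c ^ 2 ≤ S.Z t ω c ^ 2 + G.muM ^ 2 + a c ^ 2 -
      2 * S.Z t ω c * (R - a c) := by
    linarith
  -- The growth of `Us`, at most `muM`, is charged to the new squares, themselves at most `N * qM ^
  -- 2`; the old `Us` multiplies the drift of the squares.
  have k4 : T' * S.Us (t + 1) ω c / qM ≤ T * S.Us t ω c / qM + (Fintype.card N : ℝ) * qM * G.muM +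
      S.Us t ω c / qM * (D - 2 * W) := by
    have e1 : T' * S.Us (t + 1) ω c ≤ T' * S.Us t ω c + (Fintype.card N : ℝ) * qM ^ 2 * G.muM := by
      have e2 := mul_le_mul_of_nonneg_left hUsstep hT'
      have e3 := mul_le_mul_of_nonneg_right hsq hmu
      linarith
    have e4 : T' * S.Us t ω c ≤ (T + D - 2 * W) * S.Us t ω c :=
      mul_le_mul_of_nonneg_right hUsq hUs
    rw [div_le_iff₀ hq]
    have e5 : (T * S.Us t ω c / qM + (Fintype.card N : ℝ) * qM * G.muM +
        S.Us t ω c / qM * (D - 2 * W)) * qM =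
        T * S.Us t ω c + (Fintype.card N : ℝ) * qM ^ 2 * G.muM + S.Us t ω c * (D - 2 * W) := by
      field_simp
    rw [e5]
    linarith
  have k5 : S.Us t ω c / qM * (W + (qM - G.muM) * A) =
      S.Us t ω c / qM * W + (qM - G.muM) / qM * S.Us t ω c * A := by ring
  rw [k5]
  linarith

end Network.SuboptimalRun

/-- The constant `B` dominates the sum of the constants in the drifts of the flows. -/
theorem Network.sum_le_constB (G : Network N F) (qM : ℝ) (ρ a : F → ℝ) :
    ∑ c, (1 / 2 * (Fintype.card N : ℝ) * qM * G.muM + (qM - G.muM) / qM * G.muM ^ 2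
        + 1 / 2 * G.muM ^ 2 * ρ c ^ 2 + 1 / 2 * (Fintype.card N : ℝ) ^ 2 * qM ^ 2
        + 1 / 2 * G.muM ^ 2 + 1 / 2 * a c ^ 2) ≤ G.constB qM ρ a := by
  -- The factor `K` before `∑ a c ^ 2` in `constB` is generous; without flows both sides are 0.
  have ha : ∑ c, a c ^ 2 ≤ (Fintype.card F : ℝ) * ∑ c, a c ^ 2 := by
    rcases isEmpty_or_nonempty F with h | h
    · simp
    · refine le_mul_of_one_le_left (Finset.sum_nonneg fun _ _ => sq_nonneg _) ?_
      exact_mod_cast Fintype.card_pos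
  simp only [Finset.sum_add_distrib, Finset.sum_const, Finset.card_univ, nsmul_eq_mul,
    ← Finset.mul_sum]
  unfold Network.constB
  linarith

end

/-! ### Total drift, telescoping and expectations -/

section

variable {N F : Type*} [Fintype N] [Fintype F] {G : Network N F} {γ ε qM V : ℝ} {ρ a r : F → ℝ}
  {Ω : Type*} [MeasurableSpace Ω] {P : Measure Ω} (S : G.SuboptimalRun γ qM V ρ a P)

namespace Network.SuboptimalRun

/-- A suboptimal scheduler serves every vector of the capacity region up to the factor `γ`, in the
weighted sense. -/
theorem sum_capacity_le (hγ : 0 ≤ γ) (hqM : G.muM < qM) {z : F → ℝ}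
    (hz : z ∈ G.capacityRegion) (t : ℕ) (ω : Ω) :
    γ * ∑ c, S.Us t ω c / qM * (qM - G.muM) * z c ≤
      ∑ c, S.Us t ω c / qM * (∑ n, (S.U t ω n c : ℝ) *
          ((outRate (S.rate t ω) n c : ℝ) - (inRate (S.rate t ω) n c : ℝ)) +
        (qM - G.muM) * (G.admitted (S.rate t ω) c : ℝ)) := by
  have hq : 0 < qM := G.muM_nonneg.trans_lt hqM
  obtain ⟨⟨hf, hcs⟩, hzero, opt, hopt, hle⟩ := S.suboptimal t ω
  rw [totalWeight_eq_sum hcs hzero, hf.sum_mul_weight] at hle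
  refine le_trans (mul_le_mul_of_nonneg_left ?_ hγ) hle
  -- The queues at `(t, ω)` act as constant coefficients, and `M` is the value of the max-weight
  -- matching for them.
  refine G.sum_mul_le_of_mem_capacityRegion hz
    (b := fun n c => S.Us t ω c / qM * (S.U t ω n c : ℝ))
    (fun n c => mul_nonneg (div_nonneg (S.Us_nonneg t ω c) hq.le) (Nat.cast_nonneg _))
    (fun c => by simp [S.U_dst]) fun μ hμ => ?_
  refine le_trans (le_of_eq ?_) (hopt.sum_mul_le (S.cs_argmax t ω) hμ)
  rw [hμ.sum_mul_weight]
  refine Finset.sum_congr rfl fun c _ => ?_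
  simp_rw [mul_add, Finset.mul_sum, mul_assoc]

/-- The sample-path drift of the Lyapunov function. -/
theorem sum_flowLyapunov_succ_sub_le (hγ0 : 0 ≤ γ) (hγ1 : γ ≤ 1) (hε : 0 ≤ ε)
    (hqM : G.muM < qM) (hρ : ∀ c, 0 ≤ ρ c) (ha : ∀ c, 0 ≤ a c)
    (hr : (fun c => r c + ε) ∈ G.capacityRegion) (hr0 : ∀ c, 0 ≤ r c) {δ : ℝ}
    (hδX : ∀ c, δ ≤ γ * ρ c * r c - (Fintype.card N : ℝ) * qM)
    (hδU : δ ≤ (γ * ε * (qM - G.muM) - (2 * (Fintype.card N : ℝ) - 1 + G.muM ^ 2) / 2) / qM)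
    (hδZ : ∀ c, a c + δ ≤ γ * r c) (t : ℕ) (ω : Ω) :
    ∑ c, S.flowLyapunov (t + 1) ω c - ∑ c, S.flowLyapunov t ω c ≤
      G.constB qM ρ a + V * ∑ c, S.R t ω c - δ * ∑ c, (S.Us t ω c + S.X t ω c + S.Z t ω c)
        - V * (γ * ∑ c, r c) := by
  have hcap := S.sum_capacity_le hγ0 hqM hr t ω
  have hB := G.sum_le_constB qM ρ a
  have hflow : ∀ c ∈ (univ : Finset F), S.flowLyapunov (t + 1) ω c - S.flowLyapunov t ω c ≤
      (1 / 2 * (Fintype.card N : ℝ) * qM * G.muM + (qM - G.muM) / qM * G.muM ^ 2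
        + 1 / 2 * G.muM ^ 2 * ρ c ^ 2 + 1 / 2 * (Fintype.card N : ℝ) ^ 2 * qM ^ 2
        + 1 / 2 * G.muM ^ 2 + 1 / 2 * a c ^ 2)
      - S.Us t ω c / qM * (∑ n, (S.U t ω n c : ℝ) *
          ((outRate (S.rate t ω) n c : ℝ) - (inRate (S.rate t ω) n c : ℝ)) +
        (qM - G.muM) * (G.admitted (S.rate t ω) c : ℝ))
      + γ * (S.Us t ω c / qM * (qM - G.muM) * (r c + ε))
      + V * S.R t ω c - δ * (S.Us t ω c + S.X t ω c + S.Z t ω c) - V * (γ * r c) := by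
    intro c _
    have hrM : γ * r c ≤ G.muM := by
      have h1 : r c + ε ≤ G.muM := G.le_muM_of_mem_capacityRegion hr c
      have h2 := mul_le_of_le_one_left (hr0 c) hγ1
      linarith
    have h1 := S.flowLyapunov_succ_sub_le hqM hρ ha t ω c
    have h2 : S.R t ω c * ((qM - G.muM) / qM * S.Us t ω c - S.X t ω c * ρ c - S.Z t ω c - V) ≤
        γ * r c * ((qM - G.muM) / qM * S.Us t ω c - S.X t ω c * ρ c - S.Z t ω c - V) :=
      congestionControl_mul_le (mul_nonneg hγ0 (hr0 c)) hrM
    have h3 := mul_le_mul_of_nonneg_right (hδX c) (S.X_nonneg t ω c)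
    have h4 := mul_le_mul_of_nonneg_right (hδZ c) (S.Z_nonneg ha t ω c)
    have h5 := mul_le_mul_of_nonneg_right hδU (S.Us_nonneg t ω c)
    -- The scheduler is compared at `r + ε` and the controller at `r`; the difference in `ε` has to
    -- pay for the squared rates.
    have h6 : (γ * ε * (qM - G.muM) - (2 * (Fintype.card N : ℝ) - 1 + G.muM ^ 2) / 2) / qM *
        S.Us t ω c = γ * (S.Us t ω c / qM * (qM - G.muM) * (r c + ε)) -
          γ * r c * ((qM - G.muM) / qM * S.Us t ω c) -
          S.Us t ω c / qM * ((2 * (Fintype.card N : ℝ) - 1 + G.muM ^ 2) / 2) := by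
      ring
    linarith
  have hsum := Finset.sum_le_sum hflow
  rw [Finset.sum_sub_distrib, Finset.sum_sub_distrib, Finset.sum_sub_distrib,
    Finset.sum_add_distrib, Finset.sum_add_distrib, Finset.sum_sub_distrib] at hsum
  simp only [← Finset.mul_sum] at hsum
  linarith

/-- The drift bound telescopes along each path from the value 0, and the final Lyapunov value is
dropped as nonnegative. Expectations enter only afterwards, so no conditioning is needed. -/
theorem mul_sum_virtual_le (hqM : G.muM < qM) {B δ g : ℝ}
    (hdrift : ∀ t ω, ∑ c, S.flowLyapunov (t + 1) ω c - ∑ c, S.flowLyapunov t ω c ≤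
      B + V * ∑ c, S.R t ω c - δ * ∑ c, (S.Us t ω c + S.X t ω c + S.Z t ω c) - V * g)
    [IsProbabilityMeasure P] (t : ℕ) :
    δ * ∑ τ ∈ range t, ∑ c, ∫ ω, (S.Us τ ω c + S.X τ ω c + S.Z τ ω c) ∂P ≤
      B * t + V * (∑ τ ∈ range t, ∑ c, ∫ ω, S.R τ ω c ∂P - g * t) := by
  have hpath : ∀ ω, δ * ∑ τ ∈ range t, ∑ c, (S.Us τ ω c + S.X τ ω c + S.Z τ ω c) ≤
      V * (∑ τ ∈ range t, ∑ c, S.R τ ω c) + (B * t - V * (g * t)) := by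
    intro ω
    have h : ∑ c, S.flowLyapunov t ω c +
        δ * ∑ τ ∈ range t, ∑ c, (S.Us τ ω c + S.X τ ω c + S.Z τ ω c) ≤
        V * (∑ τ ∈ range t, ∑ c, S.R τ ω c) + (B * t - V * (g * t)) := by
      induction t with
      | zero => simp [S.flowLyapunov_zero]
      | succ t ih =>
        have := hdrift t ω
        rw [Finset.sum_range_succ, Finset.sum_range_succ]
        push_cast
        linarith
    have h0 : 0 ≤ ∑ c, S.flowLyapunov t ω c :=
      Finset.sum_nonneg fun c _ => S.flowLyapunov_nonneg hqM t ω c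
    linarith
  have hQ : ∀ τ, ∀ c ∈ (univ : Finset F),
      Integrable (fun ω => S.Us τ ω c + S.X τ ω c + S.Z τ ω c) P := fun τ c _ =>
    ((S.integrable_virtual hqM τ c).1.add (S.integrable_virtual hqM τ c).2.1).add
      (S.integrable_virtual hqM τ c).2.2
  have hR : ∀ τ, ∀ c ∈ (univ : Finset F), Integrable (fun ω => S.R τ ω c) P := fun τ c _ =>
    S.integrable_R hqM τ c
  have hQs := fun τ (_ : τ ∈ range t) => integrable_finsetSum _ (hQ τ)
  have hRs := fun τ (_ : τ ∈ range t) => integrable_finsetSum _ (hR τ)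
  have h := integral_mono ((integrable_finsetSum _ hQs).const_mul δ)
    (((integrable_finsetSum _ hRs).const_mul V).add (integrable_const (B * t - V * (g * t)))) hpath
  rw [integral_add' ((integrable_finsetSum _ hRs).const_mul V) (integrable_const _),
    integral_const_mul, integral_const_mul, integral_finsetSum _ hQs, integral_finsetSum _ hRs,
    integral_const, probReal_univ, one_smul] at h
  simp_rw [fun τ => integral_finsetSum _ (hQ τ), fun τ => integral_finsetSum _ (hR τ)] at h
  linarith

theorem sum_integral_R_le (hqM : G.muM < qM) [IsProbabilityMeasure P] (t : ℕ) :
    ∑ τ ∈ range t, ∑ c, ∫ ω, S.R τ ω c ∂P ≤ (Fintype.card F : ℝ) * G.muM * t := by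
  have h : ∀ τ c, ∫ ω, S.R τ ω c ∂P ≤ G.muM := by
    intro τ c
    have := integral_mono (S.integrable_R hqM τ c) (integrable_const G.muM) (S.R_le τ · c)
    simpa using this
  refine (Finset.sum_le_sum fun τ _ => Finset.sum_le_sum fun c _ => h τ c).trans (le_of_eq ?_)
  simp only [Finset.sum_const, Finset.card_univ, Finset.card_range, nsmul_eq_mul]
  ring

end Network.SuboptimalRun

/-- Affine domination between two real sequences passes to the upper limits. -/
theorem limsup_coe_le_of_affine {u v : ℕ → ℝ} {x A k : ℝ} (hk : 0 < k)
    (huv : ∀ᶠ t in atTop, v t ≤ A + k * u t)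
    (hu : limsup (fun t => (u t : EReal)) atTop ≤ (x : EReal)) :
    limsup (fun t => (v t : EReal)) atTop ≤ ((A + k * x : ℝ) : EReal) := by
  -- Testing against real `y` above the bound keeps the affine arithmetic in the reals.
  refine EReal.le_of_forall_lt_iff_le.1 fun y hy => ?_
  have hy' : A + k * x < y := by exact_mod_cast hy
  have hlt : limsup (fun t => (u t : EReal)) atTop < (((y - A) / k : ℝ) : EReal) := by
    refine hu.trans_lt ?_
    rw [EReal.coe_lt_coe_iff, lt_div_iff₀ hk]
    linarith
  refine limsup_le_of_le (by isBoundedDefault) ?_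
  filter_upwards [eventually_lt_of_limsup_lt hlt, huv] with t h1 h2
  rw [EReal.coe_lt_coe_iff, lt_div_iff₀ hk] at h1
  rw [EReal.coe_le_coe_iff]
  linarith

/-- Finitely many positive upper bounds all hold for points just to the right of 0; this also covers
an empty set of flows. -/
theorem Network.exists_isMargin (G : Network N F) (hqM : 0 < qM)
    (hX : ∀ c, 0 < γ * ρ c * r c - (Fintype.card N : ℝ) * qM)
    (hU : 0 < γ * ε * (qM - G.muM) - (2 * (Fintype.card N : ℝ) - 1 + G.muM ^ 2) / 2) :
    ∃ ε₁, G.IsMargin γ ε qM ρ r ε₁ := by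
  have h1 : ∀ᶠ y in nhdsWithin (0 : ℝ) (Set.Ioi 0),
      ∀ c, y ≤ γ * ρ c * r c - (Fintype.card N : ℝ) * qM :=
    eventually_all.2 fun c => nhdsWithin_le_nhds ((gt_mem_nhds (hX c)).mono fun _ h => h.le)
  have h2 := nhdsWithin_le_nhds (s := Set.Ioi (0 : ℝ)) (gt_mem_nhds (div_pos hU hqM))
  obtain ⟨y, hy0, hy1, hy2⟩ :=
    ((eventually_mem_nhdsWithin (a := (0 : ℝ)) (s := Set.Ioi 0)).and (h1.and h2)).exists
  exact ⟨y, hy0, hy1, hy2.le⟩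

end

end DelayNet

/-! ### The queue bounds and the throughput bound -/

theorem theorem2 {N F : Type*} [Fintype N] [Fintype F] (G : DelayNet.Network N F)
    (γ ε ε₂ qM V : ℝ) (ρ a r : F → ℝ)
    (hγ0 : 0 < γ) (hγ1 : γ < 1) (hε : 0 < ε) (hV : 0 < V) (ha : ∀ c, 0 ≤ a c)
    (hr : G.IsOptimalRate a ε r)
    (hqM : (2 * (Fintype.card N : ℝ) - 1 + G.muM ^ 2) / (2 * γ * ε) + G.muM < qM)
    (hρ : ∀ c, (Fintype.card N : ℝ) * qM / (γ * r c) < ρ c)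
    (hε₂ : 0 < ε₂) (hra : ∀ c, a c + ε₂ ≤ γ * r c)
    {Ω : Type*} [MeasurableSpace Ω] (P : MeasureTheory.Measure Ω)
    [MeasureTheory.IsProbabilityMeasure P]
    (S : G.SuboptimalRun γ qM V ρ a P) :
    -- all expectations are those of integrable variables
    (∀ t c, MeasureTheory.Integrable (fun ω => S.R t ω c) P ∧
      MeasureTheory.Integrable (fun ω => S.Us t ω c) P ∧
      MeasureTheory.Integrable (fun ω => S.X t ω c) P ∧
      MeasureTheory.Integrable (fun ω => S.Z t ω c) P) ∧
    -- the time-averaged bound on the virtual queues, with `δ = min {ε₁, ε₂}`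
    (∃ ε₁, G.IsMargin γ ε qM ρ r ε₁) ∧
    (∀ ε₁, G.IsMargin γ ε qM ρ r ε₁ →
      (∀ B_R : ℝ,
        Filter.limsup S.avgInput Filter.atTop ≤ ((γ * (∑ c, r c + B_R) : ℝ) : EReal) →
        Filter.limsup S.avgVirtual Filter.atTop ≤
          (((G.constB qM ρ a + γ * V * B_R) / min ε₁ ε₂ : ℝ) : EReal)) ∧
      Filter.limsup S.avgVirtual Filter.atTop ≤
        (((G.constB qM ρ a + V * ((Fintype.card F : ℝ) * G.muM)) / min ε₁ ε₂ : ℝ) : EReal)) ∧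
    -- the throughput
    ((γ * ∑ c, r c - G.constB qM ρ a / V : ℝ) : EReal) ≤
      Filter.liminf S.avgInput Filter.atTop := by
  have hγr : ∀ c, 0 < γ * r c := fun c => by linarith [ha c, hra c]
  have hr0 : ∀ c, 0 < r c := fun c => pos_of_mul_pos_right (hγr c) hγ0.le
  have hD : 0 ≤ 2 * (Fintype.card N : ℝ) - 1 + G.muM ^ 2 := by
    have h1 := one_le_pow₀ G.one_le_muM (n := 2)
    have h2 : (0 : ℝ) ≤ Fintype.card N := Nat.cast_nonneg _
    linarith
  have hq : G.muM < qM := by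
    have : 0 ≤ (2 * (Fintype.card N : ℝ) - 1 + G.muM ^ 2) / (2 * γ * ε) := by positivity
    linarith
  have hq0 : 0 < qM := G.muM_nonneg.trans_lt hq
  have hρ0 : ∀ c, 0 ≤ ρ c := fun c =>
    (div_nonneg (mul_nonneg (Nat.cast_nonneg _) hq0.le) (hγr c).le).trans (hρ c).le
  have hU : 0 < γ * ε * (qM - G.muM) - (2 * (Fintype.card N : ℝ) - 1 + G.muM ^ 2) / 2 := by
    have h1 := lt_sub_iff_add_lt.2 hqM
    rw [div_lt_iff₀ (by positivity)] at h1
    linarith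
  have hX : ∀ c, 0 < γ * ρ c * r c - (Fintype.card N : ℝ) * qM := fun c => by
    have h1 := hρ c
    rw [div_lt_iff₀ (hγr c)] at h1
    linarith
  obtain ⟨ε₀, hε₀⟩ := G.exists_isMargin hq0 hX hU
  have key : ∀ ε₁, G.IsMargin γ ε qM ρ r ε₁ → ∀ t : ℕ,
      min ε₁ ε₂ * ∑ τ ∈ Finset.range t, ∑ c, ∫ ω, (S.Us τ ω c + S.X τ ω c + S.Z τ ω c) ∂P ≤
        G.constB qM ρ a * t + V * (∑ τ ∈ Finset.range t, ∑ c, ∫ ω, S.R τ ω c ∂P -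
          γ * (∑ c, r c) * t) := fun ε₁ h₁ =>
    S.mul_sum_virtual_le hq (S.sum_flowLyapunov_succ_sub_le hγ0.le hγ1.le hε.le hq hρ0 ha hr.1.1
      (fun c => (hr0 c).le) (fun c => (min_le_left _ _).trans (h₁.2.1 c))
      ((min_le_left _ _).trans h₁.2.2)
      fun c => (add_le_add_right (min_le_right _ _) _).trans (hra c))
  refine ⟨fun t c => ⟨S.integrable_R hq t c, S.integrable_virtual hq t c⟩, ⟨ε₀, hε₀⟩,
    fun ε₁ h₁ => ⟨fun B_R hB => ?_, ?_⟩, ?_⟩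
  · have hδ : 0 < min ε₁ ε₂ := lt_min h₁.1 hε₂
    -- `A` and `k` come from dividing `key` by `min ε₁ ε₂ * t`; the `γ * ∑ r` inside `A` cancels the
    -- one in the hypothesis on `B_R`.
    refine (DelayNet.limsup_coe_le_of_affine (A := (G.constB qM ρ a - V * (γ * ∑ c, r c)) /
      min ε₁ ε₂) (k := V / min ε₁ ε₂) (div_pos hV hδ) ?_ hB).trans (le_of_eq ?_)
    · filter_upwards [eventually_gt_atTop 0] with t ht
      have ht' : (0 : ℝ) < t := by exact_mod_cast ht
      have h := key ε₁ h₁ t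
      rw [div_mul_eq_mul_div, ← add_div, le_div_iff₀ hδ, mul_comm, ← mul_div_assoc,
        div_le_iff₀ ht']
      refine h.trans (le_of_eq ?_)
      field_simp
      ring
    · congr 1
      field_simp
      ring
  · have hδ : 0 < min ε₁ ε₂ := lt_min h₁.1 hε₂
    refine limsup_le_of_le (by isBoundedDefault) ?_
    filter_upwards [eventually_gt_atTop 0] with t ht
    have ht' : (0 : ℝ) < t := by exact_mod_cast ht
    have h := key ε₁ h₁ t
    -- The inputs are bounded by `K * muM` per slot and the term in `∑ r` is discarded, so the bound
    -- holds at every `t > 0`.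
    have h2 := mul_le_mul_of_nonneg_left (S.sum_integral_R_le hq t) hV.le
    have h3 : 0 ≤ V * (γ * (∑ c, r c) * t) :=
      mul_nonneg hV.le (mul_nonneg (mul_nonneg hγ0.le
        (Finset.sum_nonneg fun c _ => (hr0 c).le)) ht'.le)
    refine EReal.coe_le_coe_iff.2 ?_
    rw [div_le_div_iff₀ ht' hδ]
    linarith
  · refine le_liminf_of_le (by isBoundedDefault) ?_
    filter_upwards [eventually_gt_atTop 0] with t ht
    have ht' : (0 : ℝ) < t := by exact_mod_cast ht
    -- Any margin serves here, since the queue term is only used through its sign.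
    have h := key ε₀ hε₀ t
    have h2 : 0 ≤ min ε₀ ε₂ *
        ∑ τ ∈ Finset.range t, ∑ c, ∫ ω, (S.Us τ ω c + S.X τ ω c + S.Z τ ω c) ∂P :=
      mul_nonneg (lt_min hε₀.1 hε₂).le (Finset.sum_nonneg fun τ _ => Finset.sum_nonneg fun c _ =>
        integral_nonneg fun ω => add_nonneg (add_nonneg (S.Us_nonneg τ ω c) (S.X_nonneg τ ω c))
          (S.Z_nonneg ha τ ω c))
    refine EReal.coe_le_coe_iff.2 ?_
    rw [le_div_iff₀ ht', sub_mul, div_mul_eq_mul_div, sub_le_iff_le_add, ← sub_le_iff_le_add',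
      le_div_iff₀ hV]
    linarith
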